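/- Let $N\ge 1$ be an integer and $\theta\in\mathbb R$. For $a>0$, a gamma($a$) variable is a real random variable with density $\frac{t^{a-1}}{\Gamma(a)}e^{-t}$ on $(0,\infty)$. Let $V_N$ be a random matrix distributed according to the normalized Haar measure on the unitary group $U(N)$, and let $Z_N=\det\left(I_N-e^{-i\theta}V_N\right)$. Let $\gamma_1,\dots,\gamma_N,\gamma'_1,\dots,\gamma'_N$ be random variables, where $\gamma_j$ and $\gamma'_j$ are gamma($j$) variables, such that $V_N,\gamma_1,\dots,\gamma_N,\gamma'_1,\dots,\gamma'_N$ are all independent. Then $$\prod_{j=1}^N\gamma_j\ \overset{\mathrm{law}}{=}\ |Z_N|\prod_{j=1}^N\sqrt{\gamma_j\gamma'_j}.$$ -/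

import Mathlib

noncomputable section

namespace CharPolyHaar

/-- The Borel σ-algebra of the unitary group `U(N)`, for the topology inherited from the entries. -/
instance instMeasurableSpaceUnitary (N : ℕ) : MeasurableSpace (Matrix.unitaryGroup (Fin N) ℂ) :=
  borel _

instance instBorelSpaceUnitary (N : ℕ) : BorelSpace (Matrix.unitaryGroup (Fin N) ℂ) := ⟨rfl⟩

theorem isCompact_unitaryGroup (N : ℕ) :
    IsCompact (Matrix.unitaryGroup (Fin N) ℂ : Set (Matrix (Fin N) (Fin N) ℂ)) := by
  have hK : IsCompact (Set.univ.pi fun _ : Fin N => Set.univ.pi fun _ : Fin N =>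
      Metric.closedBall (0 : ℂ) 1) :=
    isCompact_univ_pi fun _ => isCompact_univ_pi fun _ => isCompact_closedBall _ _
  refine IsCompact.of_isClosed_subset hK ?_ ?_
  · have : (Matrix.unitaryGroup (Fin N) ℂ : Set (Matrix (Fin N) (Fin N) ℂ))
        = {A | A * star A = 1} := by
      ext A
      exact Matrix.mem_unitaryGroup_iff
    rw [this]
    exact isClosed_eq (by fun_prop) continuous_const
  · intro A hA i _ j _
    simpa using entry_norm_bound_of_unitary hA i j

instance instCompactSpaceUnitary (N : ℕ) : CompactSpace (Matrix.unitaryGroup (Fin N) ℂ) :=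
  isCompact_iff_compactSpace.mp (isCompact_unitaryGroup N)

/-- The Haar measure on `U(N)`, normalized to total mass `1`. -/
def haarUnitary (N : ℕ) : MeasureTheory.Measure (Matrix.unitaryGroup (Fin N) ℂ) :=
  MeasureTheory.Measure.haarMeasure ⊤

/-- The characteristic polynomial `Z(V, θ) = det (I - e^{-iθ} V)` of a unitary matrix `V`. -/
def Z {N : ℕ} (V : Matrix.unitaryGroup (Fin N) ℂ) (θ : ℝ) : ℂ :=
  (1 - Complex.exp (-(Complex.I * (θ : ℂ))) • (V : Matrix (Fin N) (Fin N) ℂ)).det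

end CharPolyHaar

end

noncomputable section

open MeasureTheory ProbabilityTheory Set
open scoped ENNReal NNReal Nat

namespace CharPolyHaar

/-! The modulus of the characteristic polynomial splits in law into independent factors, and each
factor is matched with one gamma variable. Let `U` be Haar on U(N+1), with last diagonal entry `u`,
and `V` an independent Haar matrix on U(N), embedded as a block. By invariance `U V` is again Haar,
and det(1 - U V) = (1 - u) det(1 - W V) with `W` unitary and depending on `U` alone; invariance on
U(N) absorbs `W`. Thus |det(1 - V)| is in law a product of independent |1 - u|, one for each size
(`charNormLaw_eq_prodLaw`). The moments of |u| come from a Gaussian integral, invariance under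
phases kills the mixed moments, and Vandermonde's identity gives E|1 - u|^(2n) = N! (N+2n)! /
(N+n)!^2. Multiplied by ((N+n)!/N!)^2, the moment of the geometric mean of two gamma(N+1) variables,
this is (N+2n)!/N!, the moment of order 2n of gamma(N+1). Even moments determine a law on the
half-line with a finite exponential moment (`ext_of_even_moments`), so
`cornerLaw_mconv_sqrtGammaLaw` follows, and the theorem is the product of these identities. -/

/-! ### Products of independent real variables. -/

/-- The law of the product of `n` independent real variables with laws `μ 0, …, μ (n - 1)`. -/
def prodLaw (μ : ℕ → Measure ℝ) : ℕ → Measure ℝ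
  | 0 => Measure.dirac 1
  | n + 1 => prodLaw μ n ∗ₘ μ n

instance isProbabilityMeasure_mconv (μ ν : Measure ℝ) [IsProbabilityMeasure μ]
    [IsProbabilityMeasure ν] : IsProbabilityMeasure (μ ∗ₘ ν) :=
  Measure.isProbabilityMeasure_map (by fun_prop)

instance isProbabilityMeasure_prodLaw (μ : ℕ → Measure ℝ) [∀ i, IsProbabilityMeasure (μ i)]
    (n : ℕ) : IsProbabilityMeasure (prodLaw μ n) := by
  induction n with
  | zero => exact Measure.dirac.isProbabilityMeasure
  | succ n ih => exact isProbabilityMeasure_mconv _ _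

theorem prodLaw_mconv (μ ν : ℕ → Measure ℝ) [∀ i, IsProbabilityMeasure (μ i)]
    [∀ i, IsProbabilityMeasure (ν i)] (n : ℕ) :
    prodLaw (fun i => μ i ∗ₘ ν i) n = prodLaw μ n ∗ₘ prodLaw ν n := by
  induction n with
  | zero => simp [prodLaw]
  | succ n ih =>
    simp only [prodLaw]
    rw [ih, Measure.mconv_assoc, Measure.mconv_assoc, ← Measure.mconv_assoc (prodLaw ν n),
      Measure.mconv_comm (prodLaw ν n) (μ n), Measure.mconv_assoc]

theorem hasLaw_prod_fin {Ω : Type*} [MeasurableSpace Ω] {P : Measure Ω} [IsProbabilityMeasure P]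
    (μ : ℕ → Measure ℝ) [∀ i, IsProbabilityMeasure (μ i)] :
    ∀ (n : ℕ) (X : Fin n → Ω → ℝ), (∀ j : Fin n, HasLaw (X j) (μ j) P) → iIndepFun X P →
      HasLaw (fun ω => ∏ j, X j ω) (prodLaw μ n) P
  | 0, X, _, _ => by
    simp only [Finset.univ_eq_empty, Finset.prod_empty, prodLaw]
    exact hasLaw_dirac_of_ae_eq (by rfl)
  | n + 1, X, hX, h => by
    have h1 := hasLaw_prod_fin μ n (fun j => X j.castSucc) (fun j => hX j.castSucc)
      (h.precomp (Fin.castSucc_injective n))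
    have hind : IndepFun (fun ω => ∏ j : Fin n, X j.castSucc ω) (X (Fin.last n)) P := by
      have := h.indepFun_finsetProd_of_notMem₀ (fun j => (hX j).aemeasurable)
        (s := Finset.univ.map Fin.castSuccEmb) (i := Fin.last n) (by simp)
      convert this using 1
      ext ω
      simp
    simp_rw [Fin.prod_univ_castSucc]
    exact hind.hasLaw_fun_mul h1 (hX (Fin.last n))

/-- Pairing up the members of two jointly independent families gives an independent family. -/
theorem iIndepFun_prodMk_sumElim {Ω : Type*} [MeasurableSpace Ω] {P : Measure Ω}
    [IsProbabilityMeasure P] {ι : Type*} [Fintype ι] {μ ν : ι → Measure ℝ}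
    [∀ i, IsProbabilityMeasure (μ i)] [∀ i, IsProbabilityMeasure (ν i)] {X Y : ι → Ω → ℝ}
    (hX : ∀ i, HasLaw (X i) (μ i) P) (hY : ∀ i, HasLaw (Y i) (ν i) P)
    (h : iIndepFun (fun k : ι ⊕ ι => Sum.elim X Y k) P) :
    iIndepFun (fun i ω => (X i ω, Y i ω)) P := by
  have hpair : ∀ i, HasLaw (fun ω => (X i ω, Y i ω)) ((μ i).prod (ν i)) P := fun i => by
    have := h.indepFun (i := Sum.inl i) (j := Sum.inr i) (by simp)
    exact this.hasLaw_prod (hX i) (hY i)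
  rw [iIndepFun_iff_hasLaw_pi_pi hpair]
  have hall : HasLaw (fun ω (k : ι ⊕ ι) => Sum.elim X Y k ω) (Measure.pi (Sum.elim μ ν)) P := by
    refine h.hasLaw_pi ?_
    rintro (i | i)
    · exact hX i
    · exact hY i
  have : ∀ k, IsProbabilityMeasure (Sum.elim μ ν k) := by
    rintro (i | i) <;> simp only [Sum.elim_inl, Sum.elim_inr] <;> infer_instance
  have h1 := (measurePreserving_sumPiEquivProdPi (X := fun _ : ι ⊕ ι => ℝ)
    (Sum.elim μ ν)).comp_hasLaw hall
  exact (measurePreserving_arrowProdEquivProdArrow ℝ ℝ ι μ ν).symm.comp_hasLaw h1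

/-! ### Determination of a law by its even moments. -/

/-- The power series of cosh has nonnegative terms and even powers only, so the exchange of sum and
integral in [0, ∞] needs no integrability. -/
theorem lintegral_cosh_mul (μ : Measure ℝ) (t : ℝ) :
    ∫⁻ x, ENNReal.ofReal (Real.cosh (t * x)) ∂μ =
      ∑' n : ℕ, ENNReal.ofReal (t ^ (2 * n) / (2 * n)!) * ∫⁻ x, ENNReal.ofReal (x ^ (2 * n)) ∂μ := by
  have key : ∀ x : ℝ, ENNReal.ofReal (Real.cosh (t * x)) =
      ∑' n : ℕ, ENNReal.ofReal (t ^ (2 * n) / (2 * n)!) * ENNReal.ofReal (x ^ (2 * n)) := fun x => by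
    have hs := Real.hasSum_cosh (t * x)
    rw [← hs.tsum_eq, ENNReal.ofReal_tsum_of_nonneg _ hs.summable]
    · refine tsum_congr fun n => ?_
      rw [← ENNReal.ofReal_mul (div_nonneg ((even_two_mul n).pow_nonneg t) (by positivity)), mul_pow]
      congr 1
      ring
    · exact fun n => div_nonneg ((even_two_mul n).pow_nonneg _) (by positivity)
  simp_rw [key]
  rw [lintegral_tsum (fun n => by fun_prop)]
  refine tsum_congr fun n => ?_
  rw [lintegral_const_mul _ (by fun_prop)]

/-- The sum of a measure and of its reflection in the origin. -/
def symmetrized (μ : Measure ℝ) : Measure ℝ := μ + μ.map Neg.neg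

instance isFiniteMeasure_symmetrized (μ : Measure ℝ) [IsFiniteMeasure μ] :
    IsFiniteMeasure (symmetrized μ) := by
  unfold symmetrized
  infer_instance

theorem lintegral_exp_symmetrized (μ : Measure ℝ) (t : ℝ) :
    ∫⁻ x, ENNReal.ofReal (Real.exp (t * x)) ∂(symmetrized μ) =
      2 * ∫⁻ x, ENNReal.ofReal (Real.cosh (t * x)) ∂μ := by
  rw [symmetrized, lintegral_add_measure, lintegral_map (by fun_prop) measurable_neg,
    ← lintegral_add_left (by fun_prop), ← lintegral_const_mul _ (by fun_prop)]
  refine lintegral_congr fun x => ?_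
  rw [← ENNReal.ofReal_add (by positivity) (by positivity), Real.cosh_eq,
    show (2 : ℝ≥0∞) = ENNReal.ofReal 2 by simp, ← ENNReal.ofReal_mul (by norm_num)]
  congr 1
  rw [mul_neg]
  ring

theorem map_abs_symmetrized {μ : Measure ℝ} (h : ∀ᵐ x ∂μ, 0 ≤ x) :
    (symmetrized μ).map (fun x => |x|) = μ + μ := by
  have h1 : μ.map (fun x : ℝ => |x|) = μ := by
    refine (Measure.map_congr (h.mono fun x hx => ?_)).trans Measure.map_id
    exact abs_of_nonneg hx
  rw [symmetrized, Measure.map_add _ _ (by fun_prop), Measure.map_map (by fun_prop) measurable_neg]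
  simp only [Function.comp_def, abs_neg, h1]

/-- A law on the half-line some exponential moment of which is finite is determined by its
moments of even order. -/
theorem ext_of_even_moments {μ ν : Measure ℝ} [IsProbabilityMeasure μ] [IsProbabilityMeasure ν]
    (hμ : ∀ᵐ x ∂μ, 0 ≤ x) (hν : ∀ᵐ x ∂ν, 0 ≤ x)
    (h : ∀ n : ℕ, ∫⁻ x, ENNReal.ofReal (x ^ (2 * n)) ∂μ = ∫⁻ x, ENNReal.ofReal (x ^ (2 * n)) ∂ν)
    {s : ℝ} (hs : 0 < s) (hfin : ∫⁻ x, ENNReal.ofReal (Real.exp (s * x)) ∂ν ≠ ∞) : μ = ν := by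
  have hexp : ∀ t : ℝ, ∫⁻ x, ENNReal.ofReal (Real.exp (t * x)) ∂(symmetrized μ) =
      ∫⁻ x, ENNReal.ofReal (Real.exp (t * x)) ∂(symmetrized ν) := fun t => by
    simp only [lintegral_exp_symmetrized, lintegral_cosh_mul, h]
  have hmgf : mgf id (symmetrized μ) = mgf id (symmetrized ν) := by
    ext t
    simp only [mgf, id]
    rw [integral_eq_lintegral_of_nonneg_ae (.of_forall fun x => (Real.exp_pos _).le)
      (by fun_prop), integral_eq_lintegral_of_nonneg_ae (.of_forall fun x => (Real.exp_pos _).le)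
      (by fun_prop), hexp]
  -- Finiteness is needed for `ν` only: `hexp` carries it over to `μ`.
  have hsub : Ioo (-s) s ⊆ integrableExpSet id (symmetrized μ) := by
    intro t ht
    refine ⟨by fun_prop, ?_⟩
    rw [hasFiniteIntegral_iff_ofReal (.of_forall fun x => (Real.exp_pos _).le)]
    simp only [id]
    rw [hexp, lintegral_exp_symmetrized]
    refine ENNReal.mul_lt_top (by simp) (lt_of_le_of_lt (lintegral_mono_ae ?_) hfin.lt_top)
    filter_upwards [hν] with x hx
    refine ENNReal.ofReal_le_ofReal ?_
    rw [Real.cosh_eq]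
    have h1 : Real.exp (t * x) ≤ Real.exp (s * x) :=
      Real.exp_le_exp.2 (mul_le_mul_of_nonneg_right ht.2.le hx)
    have h2 : Real.exp (-(t * x)) ≤ Real.exp (s * x) :=
      Real.exp_le_exp.2 (by nlinarith [ht.1])
    linarith
  have h0 : (0 : ℝ) ∈ interior (integrableExpSet id (symmetrized μ)) :=
    interior_maximal hsub isOpen_Ioo ⟨by linarith, hs⟩
  have hne : ∀ (ρ : Measure ℝ) [IsProbabilityMeasure ρ], symmetrized ρ ≠ 0 := fun ρ _ h0 => by
    have := congrArg (fun m : Measure ℝ => m univ) h0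
    simp [symmetrized] at this
  have hsymm : symmetrized μ = symmetrized ν := by
    refine Measure.ext_of_charFun ?_
    ext t
    rw [← complexMGF_id_mul_I, ← complexMGF_id_mul_I]
    refine eqOn_complexMGF_of_mgf' hmgf (by simp [hne]) ?_
    simpa using h0
  -- The absolute value folds the symmetrized laws back onto the half-line.
  have h2 : μ + μ = ν + ν := by
    rw [← map_abs_symmetrized hμ, ← map_abs_symmetrized hν, hsymm]
  ext t _
  have h3 := congrArg (fun m : Measure ℝ => m t) h2
  simp only [Measure.add_apply, ← two_mul] at h3
  exact (ENNReal.mul_right_inj (by simp) (by simp)).1 h3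

/-! ### Moments of gamma laws. -/

theorem ae_pos_gammaMeasure (a r : ℝ) : ∀ᵐ x ∂(gammaMeasure a r), 0 < x := by
  rw [gammaMeasure, ae_withDensity_iff (by unfold gammaPDF; fun_prop)]
  have : ∀ᵐ x : ℝ, x ≠ 0 := by simp [ae_iff]
  filter_upwards [this] with x hx h
  by_contra hneg
  exact h (gammaPDF_of_neg (lt_of_le_of_ne (not_lt.1 hneg) hx))

/-- Multiplying the gamma(a) density by x^m gives a constant times the gamma(a+m) density, which has
mass 1. -/
theorem lintegral_pow_gammaMeasure {a : ℝ} (ha : 0 < a) (m : ℕ) :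
    ∫⁻ x, ENNReal.ofReal (x ^ m) ∂(gammaMeasure a 1) =
      ENNReal.ofReal (Real.Gamma (a + m) / Real.Gamma a) := by
  have ham : 0 < a + m := by positivity
  rw [gammaMeasure, lintegral_withDensity_eq_lintegral_mul _ (by unfold gammaPDF; fun_prop)
    (by fun_prop)]
  rw [← mul_one (ENNReal.ofReal (_ / _)), ← lintegral_gammaPDF_eq_one ham one_pos,
    ← lintegral_const_mul _ (by unfold gammaPDF; fun_prop)]
  have h0 : ∀ᵐ x : ℝ, x ≠ 0 := by simp [ae_iff]
  refine lintegral_congr_ae ?_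
  filter_upwards [h0] with x hx
  rcases lt_or_gt_of_ne hx with h | h
  · simp [gammaPDF_of_neg h]
  · have hG := Real.Gamma_pos_of_pos ha
    have hG' := Real.Gamma_pos_of_pos ham
    simp only [Pi.mul_apply]
    rw [gammaPDF_of_nonneg h.le, gammaPDF_of_nonneg h.le, ← ENNReal.ofReal_mul (by positivity),
      ← ENNReal.ofReal_mul (by positivity)]
    congr 1
    rw [show a + m - 1 = (a - 1) + m by ring, Real.rpow_add_natCast h.ne']
    simp only [Real.one_rpow]
    field_simp

/-- The factor e^(x/2) turns the density of rate 1 into 2^a times the density of rate 1/2. -/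
theorem lintegral_exp_half_gammaMeasure_ne_top {a : ℝ} (ha : 0 < a) :
    ∫⁻ x, ENNReal.ofReal (Real.exp (1 / 2 * x)) ∂(gammaMeasure a 1) ≠ ∞ := by
  have h : ∫⁻ x, ENNReal.ofReal (Real.exp (1 / 2 * x)) ∂(gammaMeasure a 1) =
      ENNReal.ofReal (2 ^ a) * ∫⁻ x, gammaPDF a (1 / 2) x := by
    rw [gammaMeasure, lintegral_withDensity_eq_lintegral_mul _ (by unfold gammaPDF; fun_prop)
      (by fun_prop), ← lintegral_const_mul _ (by unfold gammaPDF; fun_prop)]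
    refine lintegral_congr fun x => ?_
    rcases lt_or_ge x 0 with h | h
    · simp [gammaPDF_of_neg h]
    · have hG := Real.Gamma_pos_of_pos ha
      simp only [Pi.mul_apply]
      rw [gammaPDF_of_nonneg h, gammaPDF_of_nonneg h, ← ENNReal.ofReal_mul (by positivity),
        ← ENNReal.ofReal_mul (by positivity)]
      congr 1
      rw [show -(1 * x) = -(1 / 2 * x) + -(1 / 2 * x) by ring, Real.exp_add,
        one_div, Real.inv_rpow (by norm_num), Real.one_rpow]
      have h3 : Real.exp (-(x / 2)) * Real.exp (x / 2) = 1 := by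
        rw [← Real.exp_add]; simp
      have h4 : (2 : ℝ) ^ a ≠ 0 := by positivity
      field_simp
      linear_combination x ^ (a - 1) * h3
  rw [h, lintegral_gammaPDF_eq_one ha (by norm_num)]
  simp

/-! ### Haar measure on the unitary group. -/

instance isHaarMeasure_haarUnitary (N : ℕ) : (haarUnitary N).IsHaarMeasure := by
  unfold haarUnitary; infer_instance

instance isProbabilityMeasure_haarUnitary (N : ℕ) : IsProbabilityMeasure (haarUnitary N) :=
  ⟨Measure.haarMeasure_self (K₀ := (⊤ : TopologicalSpace.PositiveCompacts _))⟩

instance isMulRightInvariant_haarUnitary (N : ℕ) : (haarUnitary N).IsMulRightInvariant where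
  map_mul_right_eq_self g := by
    have : IsProbabilityMeasure ((haarUnitary N).map (· * g)) :=
      Measure.isProbabilityMeasure_map (by fun_prop)
    exact Measure.isHaarMeasure_eq_of_isProbabilityMeasure _ _

instance secondCountableTopology_unitaryGroup (N : ℕ) :
    SecondCountableTopology (Matrix.unitaryGroup (Fin N) ℂ) :=
  have : SecondCountableTopology (Matrix (Fin N) (Fin N) ℂ) :=
    inferInstanceAs (SecondCountableTopology (Fin N → Fin N → ℂ))
  TopologicalSpace.Subtype.secondCountableTopology _

/-! ### Compression of a unitary matrix by a Schur complement. -/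

section Blocks

open scoped ComplexOrder

open Matrix

theorem fromBlocks_one_mem_unitaryGroup {m n : Type*} [Fintype m] [DecidableEq m] [Fintype n]
    [DecidableEq n] {V : Matrix m m ℂ} (hV : V ∈ unitaryGroup m ℂ) :
    fromBlocks V 0 0 (1 : Matrix n n ℂ) ∈ unitaryGroup (m ⊕ n) ℂ := by
  rw [mem_unitaryGroup_iff, star_eq_conjTranspose] at *
  simp [fromBlocks_conjTranspose, fromBlocks_multiply, hV]

theorem submatrix_mem_unitaryGroup {m n : Type*} [Fintype m] [DecidableEq m] [Fintype n]
    [DecidableEq n] (e : m ≃ n) {U : Matrix n n ℂ} (hU : U ∈ unitaryGroup n ℂ) :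
    U.submatrix e e ∈ unitaryGroup m ℂ := by
  rw [mem_unitaryGroup_iff, star_eq_conjTranspose] at *
  rw [conjTranspose_submatrix, submatrix_mul_equiv, hU, submatrix_one_equiv]

/-- Every unitary matrix compresses, along its last coordinate, to a unitary matrix of size one
less through which the characteristic polynomials of its products with block diagonal
matrices factor. -/
theorem exists_unitary_det_one_sub_mul_fromBlocks {m : Type*} [Fintype m] [DecidableEq m]
    {M : Matrix (m ⊕ Fin 1) (m ⊕ Fin 1) ℂ} (hM : M ∈ unitaryGroup (m ⊕ Fin 1) ℂ) :
    ∃ W ∈ unitaryGroup m ℂ, ∀ V : Matrix m m ℂ,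
      (1 - M * fromBlocks V 0 0 1).det = (1 - M (Sum.inr 0) (Sum.inr 0)) * (1 - W * V).det := by
  obtain ⟨P, q, r, A, rfl⟩ : ∃ P q r A, M = fromBlocks P q r A :=
    ⟨_, _, _, _, (fromBlocks_toBlocks M).symm⟩
  set α := A 0 0 with hα
  have hA : A = α • 1 := by
    ext i j
    fin_cases i; fin_cases j
    simp [hα]
  have hcorner : fromBlocks P q r A (Sum.inr 0) (Sum.inr 0) = α := rfl
  have h1 := mem_unitaryGroup_iff'.1 hM
  rw [star_eq_conjTranspose, fromBlocks_conjTranspose, fromBlocks_multiply, ← fromBlocks_one,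
    fromBlocks_inj, hA] at h1
  obtain ⟨hPP, hPq, hqP, hqq⟩ := h1
  simp only [conjTranspose_smul, conjTranspose_one, Matrix.smul_mul, Matrix.mul_smul, Matrix.one_mul,
    Matrix.mul_one, smul_smul] at hPP hPq hqP hqq
  have hprod : ∀ V : Matrix m m ℂ, 1 - fromBlocks P q r A * fromBlocks V 0 0 1 =
      fromBlocks (1 - P * V) (-q) (-(r * V)) ((1 - α) • 1) := fun V => by
    rw [fromBlocks_multiply, ← fromBlocks_one, sub_eq_add_neg, fromBlocks_neg, fromBlocks_add, hA]
    simp [sub_eq_add_neg, add_smul]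
  by_cases h : α = 1
  -- A last column of norm 1 with corner entry 1 has `q = 0`; both sides then vanish, and any `W`
  -- serves.
  · refine ⟨1, one_mem _, fun V => ?_⟩
    have hq : q = 0 := by
      rw [h] at hqq
      exact conjTranspose_mul_self_eq_zero.1 (by simpa using hqq)
    rw [hcorner, hprod, h, hq]
    simp
  have hα1 : 1 - α ≠ 0 := sub_ne_zero.2 (Ne.symm h)
  have hα2 : 1 - star α ≠ 0 := by
    rw [← star_one ℂ, ← star_sub]
    exact star_ne_zero.2 hα1
  -- The Schur complement of the corner `1 - α` in 1 - M diag(V, 1) is 1 - P V - (1 - α)⁻¹ q r V,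
  -- which is 1 - W V for this `W`.
  refine ⟨P + (1 - α)⁻¹ • (q * r), ?_, fun V => ?_⟩
  · rw [mem_unitaryGroup_iff', star_eq_conjTranspose]
    have e1 : Pᴴ * P = 1 - rᴴ * r := eq_sub_of_add_eq hPP
    have e2 : Pᴴ * q = -(α • rᴴ) := eq_neg_of_add_eq_zero_left hPq
    have e3 : qᴴ * P = -(star α • r) := eq_neg_of_add_eq_zero_left hqP
    have e4 : qᴴ * q = (1 - star α * α) • 1 := by
      rw [sub_smul, one_smul, mul_comm]
      exact eq_sub_of_add_eq (by simpa [mul_comm] using hqq)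
    have : (P + (1 - α)⁻¹ • (q * r))ᴴ * (P + (1 - α)⁻¹ • (q * r)) =
        Pᴴ * P + (1 - α)⁻¹ • (Pᴴ * q * r) + (1 - star α)⁻¹ • (rᴴ * (qᴴ * P)) +
          ((1 - α)⁻¹ * (1 - star α)⁻¹) • (rᴴ * (qᴴ * q) * r) := by
      simp only [conjTranspose_add, conjTranspose_smul, conjTranspose_mul, add_mul, mul_add,
        Matrix.smul_mul, Matrix.mul_smul, smul_smul, Matrix.mul_assoc, star_inv₀, star_sub, star_one]
      abel
    rw [this, e1, e2, e3, e4]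
    simp only [Matrix.neg_mul, Matrix.mul_neg, Matrix.smul_mul, Matrix.mul_smul, Matrix.mul_one, smul_neg,
      smul_smul]
    have hs : -1 - (1 - α)⁻¹ * α - (1 - star α)⁻¹ * star α +
        (1 - α)⁻¹ * (1 - star α)⁻¹ * (1 - star α * α) = 0 := by
      field_simp
      ring
    calc _ = 1 + (-1 - (1 - α)⁻¹ * α - (1 - star α)⁻¹ * star α +
        (1 - α)⁻¹ * (1 - star α)⁻¹ * (1 - star α * α)) • (rᴴ * r) := by module
      _ = 1 := by rw [hs, zero_smul, add_zero]
  · have hinv : Invertible ((1 - α) • (1 : Matrix (Fin 1) (Fin 1) ℂ)) :=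
      ⟨(1 - α)⁻¹ • 1, by simp [smul_smul, hα1], by simp [smul_smul, hα1]⟩
    have hinv' : ⅟((1 - α) • (1 : Matrix (Fin 1) (Fin 1) ℂ)) = (1 - α)⁻¹ • 1 :=
      invOf_eq_right_inv (by simp [smul_smul, hα1])
    rw [hcorner, hprod, det_fromBlocks₂₂, hinv']
    congr 1
    · simp
    · congr 1
      simp only [Matrix.mul_smul, Matrix.smul_mul, Matrix.mul_one, Matrix.neg_mul, Matrix.mul_neg, neg_neg,
        add_mul, Matrix.mul_assoc, smul_neg]
      abel

end Blocks

/-! ### Recursion on the size for the law of the characteristic polynomial. -/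

/-- The embedding of `U(N)` into `U(N + 1)` as the stabilizer of the last basis vector. -/
def extendUnitary {N : ℕ} (V : Matrix.unitaryGroup (Fin N) ℂ) :
    Matrix.unitaryGroup (Fin (N + 1)) ℂ :=
  ⟨(Matrix.fromBlocks (V : Matrix (Fin N) (Fin N) ℂ) 0 0 (1 : Matrix (Fin 1) (Fin 1) ℂ)).submatrix
      finSumFinEquiv.symm finSumFinEquiv.symm,
    submatrix_mem_unitaryGroup _ (fromBlocks_one_mem_unitaryGroup V.2)⟩

theorem continuous_extendUnitary {N : ℕ} : Continuous (extendUnitary (N := N)) := by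
  unfold extendUnitary
  refine Continuous.subtype_mk ?_ _
  exact (Continuous.matrix_fromBlocks (by fun_prop) continuous_const continuous_const
    continuous_const).matrix_submatrix _ _

theorem exists_det_one_sub_mul_extendUnitary {N : ℕ} (U : Matrix.unitaryGroup (Fin (N + 1)) ℂ) :
    ∃ W : Matrix.unitaryGroup (Fin N) ℂ, ∀ V : Matrix.unitaryGroup (Fin N) ℂ,
      (1 - (U * extendUnitary V : Matrix.unitaryGroup (Fin (N + 1)) ℂ).1).det =
        (1 - U.1 (Fin.last N) (Fin.last N)) * (1 - (W * V : Matrix.unitaryGroup (Fin N) ℂ).1).det := by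
  let e : Fin N ⊕ Fin 1 ≃ Fin (N + 1) := finSumFinEquiv
  obtain ⟨W, hW, h⟩ := exists_unitary_det_one_sub_mul_fromBlocks (submatrix_mem_unitaryGroup e U.2)
  refine ⟨⟨W, hW⟩, fun V => ?_⟩
  have h1 := h V.1
  have h2 : U.1.submatrix e e (Sum.inr 0) (Sum.inr 0) = U.1 (Fin.last N) (Fin.last N) := rfl
  rw [h2] at h1
  rw [← Matrix.det_submatrix_equiv_self e]
  refine Eq.trans (congrArg Matrix.det ?_) h1
  rw [Matrix.submatrix_sub, Pi.sub_apply, Pi.sub_apply, Matrix.submatrix_one_equiv]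
  congr 1
  change (U.1 * (extendUnitary V).1).submatrix e e = _
  rw [← Matrix.submatrix_mul_equiv _ _ _ e]
  congr 1
  simp [extendUnitary, e]

/-- Right invariance inserts `extendUnitary V`, Fubini then fixes `U`, and left invariance on the
smaller group removes `W`. As `U` is fixed when `W` is chosen, `W` need not be measurable in `U`. -/
theorem lintegral_det_one_sub_succ {N : ℕ} {g : ℂ → ℝ≥0∞} (hg : Measurable g) :
    ∫⁻ U, g (1 - U.1).det ∂(haarUnitary (N + 1)) =
      ∫⁻ U, ∫⁻ V, g ((1 - U.1 (Fin.last N) (Fin.last N)) * (1 - V.1).det) ∂(haarUnitary N)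
        ∂(haarUnitary (N + 1)) := by
  have hdet : ∀ n, Continuous fun V : Matrix.unitaryGroup (Fin n) ℂ => (1 - V.1).det :=
    fun n => by fun_prop
  calc ∫⁻ U, g (1 - U.1).det ∂(haarUnitary (N + 1))
      = ∫⁻ _V, ∫⁻ U, g (1 - U.1).det ∂(haarUnitary (N + 1)) ∂(haarUnitary N) := by simp
    _ = ∫⁻ V, ∫⁻ U, g (1 - (U * extendUnitary V).1).det ∂(haarUnitary (N + 1))
          ∂(haarUnitary N) := by
        refine lintegral_congr fun V => ?_
        exact (lintegral_mul_right_eq_self (μ := haarUnitary (N + 1))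
          (fun U => g (1 - U.1).det) (extendUnitary V)).symm
    _ = ∫⁻ U, ∫⁻ V, g (1 - (U * extendUnitary V).1).det ∂(haarUnitary N)
          ∂(haarUnitary (N + 1)) := by
        refine lintegral_lintegral_swap (Measurable.aemeasurable ?_)
        refine hg.comp (Continuous.measurable ?_)
        exact (hdet (N + 1)).comp (continuous_snd.mul (continuous_extendUnitary.comp continuous_fst))
    _ = _ := by
        refine lintegral_congr fun U => ?_
        obtain ⟨W, hW⟩ := exists_det_one_sub_mul_extendUnitary U
        simp_rw [hW]
        exact lintegral_mul_left_eq_self (μ := haarUnitary N)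
          (fun V => g ((1 - U.1 (Fin.last N) (Fin.last N)) * (1 - V.1).det)) W

/-- The law of `|det (I - V)|` for a Haar distributed unitary matrix `V` of size `N`. -/
def charNormLaw (N : ℕ) : Measure ℝ :=
  (haarUnitary N).map fun V => ‖(1 - V.1).det‖

/-- The law of `|1 - u|` for the last diagonal entry `u` of a Haar distributed unitary matrix of
size `N + 1`. -/
def cornerLaw (N : ℕ) : Measure ℝ :=
  (haarUnitary (N + 1)).map fun U => ‖1 - U.1 (Fin.last N) (Fin.last N)‖

theorem measurable_norm_det_one_sub (N : ℕ) :
    Measurable fun V : Matrix.unitaryGroup (Fin N) ℂ => ‖(1 - V.1).det‖ :=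
  Continuous.measurable (by fun_prop)

theorem measurable_entry {N : ℕ} (i j : Fin N) :
    Measurable fun V : Matrix.unitaryGroup (Fin N) ℂ => V.1 i j :=
  (continuous_subtype_val.matrix_elem i j).measurable

instance isProbabilityMeasure_cornerLaw (N : ℕ) : IsProbabilityMeasure (cornerLaw N) :=
  Measure.isProbabilityMeasure_map ((measurable_entry _ _).const_sub 1).norm.aemeasurable

instance isProbabilityMeasure_charNormLaw (N : ℕ) : IsProbabilityMeasure (charNormLaw N) :=
  Measure.isProbabilityMeasure_map (measurable_norm_det_one_sub N).aemeasurable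

theorem charNormLaw_succ (N : ℕ) : charNormLaw (N + 1) = charNormLaw N ∗ₘ cornerLaw N := by
  rw [Measure.mconv_comm]
  refine Measure.ext_of_lintegral _ fun f hf => ?_
  have hc := ((measurable_entry (Fin.last N) (Fin.last N)).const_sub 1).norm
  rw [Measure.lintegral_mconv hf, charNormLaw, cornerLaw, charNormLaw,
    lintegral_map hf (measurable_norm_det_one_sub _), lintegral_map ?_ hc]
  · rw [lintegral_det_one_sub_succ (g := fun z => f ‖z‖) (hf.comp measurable_norm)]
    refine lintegral_congr fun U => ?_
    rw [lintegral_map (by fun_prop) (measurable_norm_det_one_sub _)]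
    simp_rw [norm_mul]
  · exact Measurable.lintegral_prod_right' (f := fun p : ℝ × ℝ => f (p.1 * p.2)) (by fun_prop)

theorem charNormLaw_eq_prodLaw (N : ℕ) : charNormLaw N = prodLaw cornerLaw N := by
  induction N with
  | zero => simp [charNormLaw, prodLaw]
  | succ N ih => rw [charNormLaw_succ, ih, prodLaw]

/-- The scalar unitary matrix of size `N` attached to a complex number of modulus one. -/
def scalarUnitary (N : ℕ) (z : Circle) : Matrix.unitaryGroup (Fin N) ℂ :=
  ⟨(z : ℂ) • 1, by
    rw [Matrix.mem_unitaryGroup_iff, Matrix.star_eq_conjTranspose]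
    simp [smul_smul, ← Complex.normSq_eq_conj_mul_self]⟩

theorem coe_scalarUnitary_mul {N : ℕ} (z : Circle) (V : Matrix.unitaryGroup (Fin N) ℂ) :
    (scalarUnitary N z * V).1 = (z : ℂ) • V.1 := by
  change ((z : ℂ) • (1 : Matrix (Fin N) (Fin N) ℂ)) * V.1 = _
  simp

theorem measurable_norm_Z {N : ℕ} (θ : ℝ) :
    Measurable fun V : Matrix.unitaryGroup (Fin N) ℂ => ‖Z V θ‖ := by
  unfold Z
  exact Continuous.measurable (by fun_prop)

/-- The phase is a scalar unitary factor, absorbed by left invariance. -/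
theorem hasLaw_norm_Z {N : ℕ} (θ : ℝ) :
    HasLaw (fun V => ‖Z V θ‖) (charNormLaw N) (haarUnitary N) := by
  have h : (fun V : Matrix.unitaryGroup (Fin N) ℂ => ‖Z V θ‖) =
      (fun V => ‖(1 - V.1).det‖) ∘ (scalarUnitary N (Circle.exp (-θ)) * ·) := by
    ext V
    simp only [Function.comp, coe_scalarUnitary_mul, Z, Circle.coe_exp]
    congr 5
    push_cast
    ring
  rw [h]
  refine ⟨((measurable_norm_det_one_sub N).comp (measurable_const_mul _)).aemeasurable, ?_⟩
  rw [← Measure.map_map (measurable_norm_det_one_sub N) (measurable_const_mul _),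
    map_mul_left_eq_self, charNormLaw]

/-! ### Gaussian integrals on complex Euclidean space. -/

section Gaussian

variable (N : ℕ)

/-- Lebesgue measure on `ℂ ^ N`, carried to the Euclidean space. -/
def euclideanVolume : Measure (EuclideanSpace ℂ (Fin N)) :=
  (volume : Measure (Fin N → ℂ)).map (WithLp.toLp 2)

theorem euclideanVolume_eq_map :
    euclideanVolume N = (volume : Measure (Fin N → ℂ)).map
      (PiLp.continuousLinearEquiv 2 ℝ (fun _ : Fin N => ℂ)).symm := rfl

instance isAddHaarMeasure_euclideanVolume : (euclideanVolume N).IsAddHaarMeasure := by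
  rw [euclideanVolume_eq_map]
  infer_instance

variable {N}

/-- By uniqueness of Haar measure `euclideanVolume` is a multiple of the volume, which isometries
preserve; the constant plays no role. -/
theorem map_euclideanVolume_eq_self
    (f : EuclideanSpace ℂ (Fin N) ≃ₗᵢ[ℝ] EuclideanSpace ℂ (Fin N)) :
    (euclideanVolume N).map f = euclideanVolume N := by
  have h := Measure.isAddLeftInvariant_eq_smul (euclideanVolume N)
    (volume : Measure (EuclideanSpace ℂ (Fin N)))
  rw [h, Measure.map_smul, f.measurePreserving.map_eq]

/-- A unitary matrix acts isometrically on the Euclidean space. -/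
theorem exists_isometryEquiv_of_unitary (U : Matrix.unitaryGroup (Fin N) ℂ) :
    ∃ f : EuclideanSpace ℂ (Fin N) ≃ₗᵢ[ℝ] EuclideanSpace ℂ (Fin N),
      ∀ x i, f x i = (U.1.mulVec x.ofLp) i := by
  let T : unitary (EuclideanSpace ℂ (Fin N) →L[ℂ] EuclideanSpace ℂ (Fin N)) :=
    ⟨Matrix.toEuclideanCLM (𝕜 := ℂ) U.1, by
      rw [Unitary.mem_iff, ← map_star, ← map_mul, ← map_mul]
      exact ⟨by rw [Matrix.mem_unitaryGroup_iff'.1 U.2, map_one],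
        by rw [Matrix.mem_unitaryGroup_iff.1 U.2, map_one]⟩⟩
  let g := Unitary.linearIsometryEquiv T
  refine ⟨LinearIsometryEquiv.mk (g.toLinearEquiv.restrictScalars ℝ) g.norm_map, fun x i => ?_⟩
  rfl

/-- Complete x/‖x‖ to an orthonormal basis, in position `j`. -/
theorem exists_unitary_mulVec_single (x : EuclideanSpace ℂ (Fin N)) (j : Fin N) :
    ∃ W : Matrix.unitaryGroup (Fin N) ℂ, ∀ i, x i = ‖x‖ * W.1 i j := by
  by_cases hx : x = 0
  · exact ⟨1, fun i => by simp [hx]⟩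
  have hx' : ‖x‖ ≠ 0 := norm_ne_zero_iff.2 hx
  have hv : Orthonormal ℂ (({j} : Set (Fin N)).domRestrict fun _ => ((‖x‖⁻¹ : ℝ) : ℂ) • x) := by
    refine ⟨fun i => ?_, fun i k hik => (hik (Subsingleton.elim i k)).elim⟩
    simp [norm_smul, hx']
  obtain ⟨b, hb⟩ := hv.exists_orthonormalBasis_extension_of_card_eq (by simp)
  refine ⟨⟨_, (EuclideanSpace.basisFun (Fin N) ℂ).toMatrix_orthonormalBasis_mem_unitary b⟩,
    fun i => ?_⟩
  have h := hb j rfl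
  have hx'' : (‖x‖ : ℂ) ≠ 0 := by exact_mod_cast hx'
  simp [Module.Basis.toMatrix_apply, h, mul_inv_cancel_left₀ hx'']

/-- Polar coordinates in real dimension 2(N+1). The volume of the ball stays unevaluated: it is
eliminated in `lintegral_norm_entry_pow`. -/
theorem integral_norm_pow_mul_exp (k : ℕ) :
    ∫ x, ‖x‖ ^ (2 * k) * Real.exp (-‖x‖ ^ 2) ∂(euclideanVolume (N + 1)) =
      (N + 1) * (euclideanVolume (N + 1)).real (Metric.ball 0 1) * (N + k)! := by
  rw [integral_fun_norm_addHaar (euclideanVolume (N + 1))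
    (fun y => y ^ (2 * k) * Real.exp (-y ^ 2))]
  have hdim : Module.finrank ℝ (EuclideanSpace ℂ (Fin (N + 1))) = 2 * (N + 1) := by
    rw [finrank_real_of_complex]; simp
  have : ∫ y in Ioi (0 : ℝ), y ^ (2 * (N + 1) - 1) • (y ^ (2 * k) * Real.exp (-y ^ 2)) =
      1 / 2 * (N + k)! := by
    rw [← Real.Gamma_nat_eq_factorial]
    have := integral_rpow_mul_exp_neg_rpow (p := 2) (q := 2 * (N + k) + 1) (by norm_num)
      (by linarith [(Nat.cast_nonneg N : (0:ℝ) ≤ N), (Nat.cast_nonneg k : (0:ℝ) ≤ k)])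
    rw [show ((2 * (N + k) + 1 : ℝ) + 1) / 2 = ((N + k : ℕ) : ℝ) + 1 by push_cast; ring] at this
    rw [← this]
    refine setIntegral_congr_fun measurableSet_Ioi fun y _ => ?_
    simp only [smul_eq_mul, Real.rpow_two]
    rw [← mul_assoc, ← pow_add, ← Real.rpow_natCast y (_ + _)]
    congr 2
    rw [show 2 * (N + 1) - 1 + 2 * k = 2 * (N + k) + 1 by omega]
    push_cast
    ring
  rw [hdim, this]
  simp only [smul_eq_mul, nsmul_eq_mul]
  push_cast
  ring

/-- The integrand is a product over coordinates; each of the other `N` contributes π. -/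
theorem integral_norm_coord_pow_mul_exp (k : ℕ) :
    ∫ x, ‖x (Fin.last N)‖ ^ (2 * k) * Real.exp (-‖x‖ ^ 2) ∂(euclideanVolume (N + 1)) =
      Real.pi ^ (N + 1) * k ! := by
  rw [euclideanVolume, integral_map (by fun_prop) (by fun_prop)]
  have h1 : ∀ x : Fin (N + 1) → ℂ,
      ‖WithLp.toLp 2 x (Fin.last N)‖ ^ (2 * k) * Real.exp (-‖WithLp.toLp 2 x‖ ^ 2) =
        ∏ i, ‖x i‖ ^ (if i = Fin.last N then 2 * k else 0) * Real.exp (-‖x i‖ ^ 2) := fun x => by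
    rw [EuclideanSpace.norm_sq_eq, Finset.prod_mul_distrib, ← Real.exp_sum]
    simp [pow_ite, Finset.sum_neg_distrib]
  have h2 : ∀ m : ℕ, ∫ z : ℂ, ‖z‖ ^ (2 * m) * Real.exp (-‖z‖ ^ 2) = Real.pi * m ! := fun m => by
    have := Complex.integral_rpow_mul_exp_neg_rpow (p := 2) (q := 2 * m) (by norm_num)
      (by linarith [(Nat.cast_nonneg m : (0:ℝ) ≤ m)])
    rw [show ((2 * m + 2 : ℝ)) / 2 = m + 1 by ring, Real.Gamma_nat_eq_factorial] at this
    rw [show 2 * Real.pi / 2 = Real.pi by ring] at this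
    rw [← this]
    congr 1 with z
    rw [Real.rpow_two, ← Real.rpow_natCast]
    push_cast
    rfl
  simp_rw [h1]
  rw [integral_fintype_prod_volume_eq_prod (fun i (z : ℂ) =>
    ‖z‖ ^ (if i = Fin.last N then 2 * k else 0) * Real.exp (-‖z‖ ^ 2)), Fin.prod_univ_castSucc]
  have h3 : ∀ i : Fin N, ∫ z : ℂ, ‖z‖ ^ (if i.castSucc = Fin.last N then 2 * k else 0) *
      Real.exp (-‖z‖ ^ 2) = Real.pi := fun i => by
    rw [if_neg (Fin.castSucc_lt_last i).ne]
    simpa using h2 0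
  simp_rw [h3]
  simp only [if_true]
  rw [h2, Finset.prod_const, Finset.card_univ, Fintype.card_fin, pow_succ, mul_assoc]

end Gaussian

/-! ### Moments of the corner entry of a Haar unitary matrix. -/

theorem lintegral_norm_mulVec_pow {N : ℕ} (k : ℕ) (x : EuclideanSpace ℂ (Fin (N + 1))) :
    ∫⁻ U, ENNReal.ofReal (‖(U.1.mulVec x.ofLp) (Fin.last N)‖ ^ (2 * k)) ∂(haarUnitary (N + 1)) =
      ENNReal.ofReal (‖x‖ ^ (2 * k)) *
        ∫⁻ U, ENNReal.ofReal (‖U.1 (Fin.last N) (Fin.last N)‖ ^ (2 * k))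
          ∂(haarUnitary (N + 1)) := by
  obtain ⟨W, hW⟩ := exists_unitary_mulVec_single x (Fin.last N)
  rw [← lintegral_mul_right_eq_self (μ := haarUnitary (N + 1))
    (fun U => ENNReal.ofReal (‖U.1 (Fin.last N) (Fin.last N)‖ ^ (2 * k))) W,
    ← lintegral_const_mul _ ?_]
  · refine lintegral_congr fun U => ?_
    rw [← ENNReal.ofReal_mul (by positivity), ← mul_pow]
    congr 2
    have : (U.1.mulVec x.ofLp) (Fin.last N) = ‖x‖ * (U * W).1 (Fin.last N) (Fin.last N) := by
      change _ = (‖x‖ : ℂ) * (U.1 * W.1) (Fin.last N) (Fin.last N)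
      simp only [Matrix.mulVec, dotProduct, Matrix.mul_apply, Finset.mul_sum, hW]
      exact Finset.sum_congr rfl fun i _ => by ring
    rw [this, norm_mul]
    simp
  · exact (((measurable_entry _ _).comp (measurable_mul_const W)).norm.pow_const _).ennreal_ofReal

theorem continuous_mulVec_coord {N : ℕ} (i : Fin N) :
    Continuous fun p : Matrix.unitaryGroup (Fin N) ℂ × EuclideanSpace ℂ (Fin N) =>
      (p.1.1.mulVec p.2.ofLp) i :=
  (continuous_apply i).comp (Continuous.matrix_mulVec
    (continuous_subtype_val.comp continuous_fst)
    ((PiLp.continuous_ofLp 2 _).comp continuous_snd))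

theorem measurable_mulVec_weight (N k : ℕ) :
    Measurable (Function.uncurry fun (U : Matrix.unitaryGroup (Fin (N + 1)) ℂ)
      (x : EuclideanSpace ℂ (Fin (N + 1))) =>
        ENNReal.ofReal (‖(U.1.mulVec x.ofLp) (Fin.last N)‖ ^ (2 * k) * Real.exp (-‖x‖ ^ 2))) := by
  refine Measurable.ennreal_ofReal (Continuous.measurable ?_)
  exact ((continuous_mulVec_coord (Fin.last N)).norm.pow _).mul
    (Real.continuous_exp.comp (continuous_snd.norm.pow 2).neg)

/-- The integral of |(U x)_last|^(2k) e^(-‖x‖²) over both `U` and `x` is evaluated in two ways. For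
fixed `U`, an isometry in `x` reduces it to the coordinate integral; for fixed `x`, it is ‖x‖^(2k)
e^(-‖x‖²) times the moment sought. -/
theorem lintegral_norm_entry_pow (N k : ℕ) :
    ∫⁻ U, ENNReal.ofReal (‖U.1 (Fin.last N) (Fin.last N)‖ ^ (2 * k)) ∂(haarUnitary (N + 1)) =
      ENNReal.ofReal (k ! * N ! / (N + k)!) := by
  set M := fun k : ℕ => ∫⁻ U, ENNReal.ofReal (‖U.1 (Fin.last N) (Fin.last N)‖ ^ (2 * k))
    ∂(haarUnitary (N + 1)) with hM
  set D : ℝ := (N + 1) * (euclideanVolume (N + 1)).real (Metric.ball 0 1) with hD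
  have hDpos : 0 < D := by
    have : 0 < (euclideanVolume (N + 1)).real (Metric.ball 0 1) :=
      ENNReal.toReal_pos (Metric.measure_ball_pos _ _ one_pos).ne' measure_ball_lt_top.ne
    positivity
  have hI : ∀ k, ∫⁻ x, ENNReal.ofReal (‖x‖ ^ (2 * k) * Real.exp (-‖x‖ ^ 2))
      ∂(euclideanVolume (N + 1)) = ENNReal.ofReal (D * (N + k)!) := fun k => by
    rw [← integral_norm_pow_mul_exp, ofReal_integral_eq_lintegral_ofReal]
    -- A Bochner integral with nonzero value has an integrable integrand.
    · refine not_imp_comm.1 integral_undef ?_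
      rw [integral_norm_pow_mul_exp]
      positivity
    · exact .of_forall fun x => by positivity
  have hJ : ∀ k, ∫⁻ x, ENNReal.ofReal (‖x (Fin.last N)‖ ^ (2 * k) * Real.exp (-‖x‖ ^ 2))
      ∂(euclideanVolume (N + 1)) = ENNReal.ofReal (Real.pi ^ (N + 1) * k !) := fun k => by
    rw [← integral_norm_coord_pow_mul_exp, ofReal_integral_eq_lintegral_ofReal]
    · refine not_imp_comm.1 integral_undef ?_
      rw [integral_norm_coord_pow_mul_exp]
      positivity
    · exact .of_forall fun x => by positivity
  have hJI : ∀ k, ENNReal.ofReal (Real.pi ^ (N + 1) * k !) =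
      ENNReal.ofReal (D * (N + k)!) * M k := fun k => by
    rw [← hI, ← hJ, ← lintegral_mul_const _ (by fun_prop)]
    calc _ = ∫⁻ _U, ∫⁻ x, ENNReal.ofReal (‖x (Fin.last N)‖ ^ (2 * k) * Real.exp (-‖x‖ ^ 2))
          ∂(euclideanVolume (N + 1)) ∂(haarUnitary (N + 1)) := by simp
      _ = ∫⁻ U, ∫⁻ x, ENNReal.ofReal (‖(U.1.mulVec x.ofLp) (Fin.last N)‖ ^ (2 * k) *
          Real.exp (-‖x‖ ^ 2)) ∂(euclideanVolume (N + 1)) ∂(haarUnitary (N + 1)) := by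
        refine lintegral_congr fun U => ?_
        obtain ⟨f, hf⟩ := exists_isometryEquiv_of_unitary U
        rw [← map_euclideanVolume_eq_self f, lintegral_map (by fun_prop) (by fun_prop),
          map_euclideanVolume_eq_self f]
        simp_rw [hf, f.norm_map]
      _ = ∫⁻ x, ∫⁻ U, ENNReal.ofReal (‖(U.1.mulVec x.ofLp) (Fin.last N)‖ ^ (2 * k) *
          Real.exp (-‖x‖ ^ 2)) ∂(haarUnitary (N + 1)) ∂(euclideanVolume (N + 1)) := by
        exact lintegral_lintegral_swap (measurable_mulVec_weight N k).aemeasurable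
      _ = _ := by
        refine lintegral_congr fun x => ?_
        rw [ENNReal.ofReal_mul (by positivity), mul_right_comm, ← lintegral_norm_mulVec_pow,
          ← lintegral_mul_const _ ?_]
        · exact lintegral_congr fun U => ENNReal.ofReal_mul (by positivity)
        · exact ((continuous_mulVec_coord (Fin.last N)).comp
            (Continuous.prodMk_left x)).measurable.norm.pow_const _ |>.ennreal_ofReal
  -- The case `k = 0` fixes the constant `D`.
  have hpi : Real.pi ^ (N + 1) = D * N ! := by
    have h0 := hJI 0
    simp only [hM, mul_zero, pow_zero, ENNReal.ofReal_one, lintegral_const, measure_univ, mul_one,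
      Nat.factorial_zero, Nat.cast_one, add_zero] at h0
    exact (ENNReal.ofReal_eq_ofReal_iff (by positivity) (by positivity)).1 h0
  have h1 := hJI k
  have hne : ENNReal.ofReal (D * (N + k)!) ≠ 0 := by
    rw [Ne, ENNReal.ofReal_eq_zero, not_le]; positivity
  rw [← ENNReal.mul_right_inj hne ENNReal.ofReal_ne_top, ← h1,
    ← ENNReal.ofReal_mul (by positivity), hpi]
  congr 1
  field_simp

theorem integral_norm_entry_pow (N k : ℕ) :
    ∫ U, ‖U.1 (Fin.last N) (Fin.last N)‖ ^ (2 * k) ∂(haarUnitary (N + 1)) =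
      k ! * N ! / (N + k)! := by
  rw [integral_eq_lintegral_of_nonneg_ae (.of_forall fun U => by positivity)
    ((measurable_entry _ _).norm.pow_const _).aestronglyMeasurable, lintegral_norm_entry_pow,
    ENNReal.toReal_ofReal (by positivity)]

open scoped ComplexConjugate

theorem integral_entry_pow_mul_conj_pow (N k l : ℕ) :
    ∫ U, U.1 (Fin.last N) (Fin.last N) ^ k * conj (U.1 (Fin.last N) (Fin.last N)) ^ l
      ∂(haarUnitary (N + 1)) = if k = l then ((k ! * N ! / (N + k)! : ℝ) : ℂ) else 0 := by
  split_ifs with h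
  · subst h
    rw [← integral_norm_entry_pow, ← integral_complex_ofReal]
    congr 1 with U
    rw [← mul_pow, Complex.mul_conj', ← pow_mul]
    push_cast
    rfl
  · have hkl : (k : ℝ) - l ≠ 0 := sub_ne_zero.2 (by exact_mod_cast h)
    -- The angle is chosen so that z^(k-l) = e^(iπ) = -1: the integral then equals its own opposite.
    set z : Circle := Circle.exp (Real.pi / (k - l)) with hz
    have hz1 : (z : ℂ) ^ k * conj (z : ℂ) ^ l = -1 := by
      rw [hz, Circle.coe_exp, ← Complex.exp_conj, ← Complex.exp_nat_mul, ← Complex.exp_nat_mul,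
        ← Complex.exp_add, ← Complex.exp_pi_mul_I]
      congr 1
      have hkl' : (k : ℂ) - l ≠ 0 := by exact_mod_cast hkl
      simp only [map_mul, Complex.conj_I, Complex.conj_ofReal]
      push_cast
      field_simp
      ring
    have h1 := integral_mul_left_eq_self (μ := haarUnitary (N + 1))
      (fun U => U.1 (Fin.last N) (Fin.last N) ^ k * conj (U.1 (Fin.last N) (Fin.last N)) ^ l)
      (scalarUnitary (N + 1) z)
    have h2 : ∀ U : Matrix.unitaryGroup (Fin (N + 1)) ℂ,
        (scalarUnitary (N + 1) z * U).1 (Fin.last N) (Fin.last N) ^ k *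
          conj ((scalarUnitary (N + 1) z * U).1 (Fin.last N) (Fin.last N)) ^ l =
        -(U.1 (Fin.last N) (Fin.last N) ^ k * conj (U.1 (Fin.last N) (Fin.last N)) ^ l) := fun U => by
      rw [coe_scalarUnitary_mul, Matrix.smul_apply, smul_eq_mul, map_mul, mul_pow, mul_pow,
        mul_mul_mul_comm, hz1, neg_one_mul]
    simp_rw [h2, integral_neg] at h1
    exact self_eq_neg.1 h1.symm

/-- Each term is a constant times C(n,k) C(N+n,n-k), so Vandermonde's identity applies. -/
theorem sum_choose_sq_mul (N n : ℕ) :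
    ∑ k ∈ Finset.range (n + 1), ((n.choose k : ℝ) ^ 2 * (k ! * N ! / (N + k)!)) =
      N ! * (N + 2 * n)! / ((N + n)! : ℝ) ^ 2 := by
  have h1 : ∀ k ∈ Finset.range (n + 1), ((n.choose k : ℝ) ^ 2 * (k ! * N ! / (N + k)!)) =
      N ! * n ! / (N + n)! * (n.choose k * (N + n).choose (n - k) : ℕ) := fun k hk => by
    have hk' : k ≤ n := Nat.lt_succ_iff.1 (Finset.mem_range.1 hk)
    rw [Nat.cast_mul, Nat.cast_choose ℝ hk', Nat.cast_choose ℝ (by omega : n - k ≤ N + n),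
      show N + n - (n - k) = N + k by omega]
    field_simp
  rw [Finset.sum_congr rfl h1, ← Finset.mul_sum, ← Nat.cast_sum,
    ← Finset.Nat.sum_antidiagonal_eq_sum_range_succ (fun i j => n.choose i * (N + n).choose j) n,
    ← Nat.add_choose_eq, Nat.cast_choose ℝ (by omega : n ≤ n + (N + n)),
    show n + (N + n) - n = N + n by omega, show n + (N + n) = N + 2 * n by omega]
  field_simp

/-- Expand (1 - u)^n and its conjugate; only the diagonal terms k = l survive, with sign (-1)^(2k) =
1. -/
theorem integral_norm_one_sub_entry_pow (N n : ℕ) :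
    ∫ U, ‖1 - U.1 (Fin.last N) (Fin.last N)‖ ^ (2 * n) ∂(haarUnitary (N + 1)) =
      N ! * (N + 2 * n)! / ((N + n)! : ℝ) ^ 2 := by
  have hexp : ∀ u : ℂ, ((‖1 - u‖ ^ (2 * n) : ℝ) : ℂ) =
      ∑ k ∈ Finset.range (n + 1), ∑ l ∈ Finset.range (n + 1),
        ((-1) ^ k * (n.choose k) * ((-1) ^ l * (n.choose l)) : ℂ) * (u ^ k * conj u ^ l) :=
    fun u => by
    have h : ∀ v : ℂ, (1 - v) ^ n =
        ∑ k ∈ Finset.range (n + 1), (-1) ^ k * (n.choose k) * v ^ k := fun v => by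
      rw [sub_eq_neg_add, add_pow]
      exact Finset.sum_congr rfl fun k _ => by rw [neg_pow, one_pow]; ring
    push_cast
    rw [pow_mul, ← Complex.mul_conj', mul_pow, ← map_pow, h u, map_sum,
      Finset.sum_mul_sum]
    refine Finset.sum_congr rfl fun k _ => Finset.sum_congr rfl fun l _ => ?_
    simp only [map_mul, map_pow, map_neg, map_one, map_natCast]
    ring
  have hint : ∀ k l : ℕ, Integrable (fun U : Matrix.unitaryGroup (Fin (N + 1)) ℂ =>
      U.1 (Fin.last N) (Fin.last N) ^ k * conj (U.1 (Fin.last N) (Fin.last N)) ^ l)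
      (haarUnitary (N + 1)) := fun k l => by
    refine Continuous.integrable_of_hasCompactSupport ?_ (HasCompactSupport.of_compactSpace _)
    have hc : Continuous fun U : Matrix.unitaryGroup (Fin (N + 1)) ℂ =>
        U.1 (Fin.last N) (Fin.last N) := continuous_subtype_val.matrix_elem _ _
    exact (hc.pow k).mul ((Complex.continuous_conj.comp hc).pow l)
  have : ((∫ U, ‖1 - U.1 (Fin.last N) (Fin.last N)‖ ^ (2 * n) ∂(haarUnitary (N + 1)) : ℝ) : ℂ) =
      ((N ! * (N + 2 * n)! / ((N + n)! : ℝ) ^ 2 : ℝ) : ℂ) := by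
    rw [← sum_choose_sq_mul, ← integral_complex_ofReal]
    simp_rw [hexp]
    rw [integral_finsetSum _ fun k _ => integrable_finsetSum _ fun l _ => (hint k l).const_mul _]
    push_cast
    refine Finset.sum_congr rfl fun k hk => ?_
    rw [integral_finsetSum _ fun l _ => (hint k l).const_mul _]
    simp_rw [integral_const_mul, integral_entry_pow_mul_conj_pow]
    rw [Finset.sum_eq_single_of_mem k hk fun l _ hl => by simp [hl.symm]]
    have h1 : ((-1 : ℂ) ^ k) * (-1) ^ k = 1 := by rw [← mul_pow]; simp
    simp only [if_true]
    push_cast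
    linear_combination ((n.choose k : ℂ) ^ 2 * (k ! * N ! / (N + k)!)) * h1
  exact_mod_cast this

/-! ### The factorization of gamma laws. -/

instance isProbabilityMeasure_gammaMeasure_succ (N : ℕ) :
    IsProbabilityMeasure (gammaMeasure ((N : ℝ) + 1) 1) :=
  isProbabilityMeasure_gammaMeasure (by positivity) one_pos

/-- The law of the geometric mean of two independent gamma variables of parameter `N + 1`. -/
def sqrtGammaLaw (N : ℕ) : Measure ℝ :=
  ((gammaMeasure ((N : ℝ) + 1) 1).prod (gammaMeasure ((N : ℝ) + 1) 1)).map
    fun p => √(p.1 * p.2)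

instance isProbabilityMeasure_sqrtGammaLaw (N : ℕ) : IsProbabilityMeasure (sqrtGammaLaw N) :=
  Measure.isProbabilityMeasure_map (by fun_prop)

theorem lintegral_pow_gammaMeasure_succ (N m : ℕ) :
    ∫⁻ x, ENNReal.ofReal (x ^ m) ∂(gammaMeasure ((N : ℝ) + 1) 1) =
      ENNReal.ofReal ((N + m)! / N !) := by
  rw [lintegral_pow_gammaMeasure (by positivity), Real.Gamma_nat_eq_factorial,
    ← Real.Gamma_nat_eq_factorial (N + m)]
  push_cast
  rw [add_right_comm]

theorem lintegral_pow_sqrtGammaLaw (N n : ℕ) :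
    ∫⁻ x, ENNReal.ofReal (x ^ (2 * n)) ∂(sqrtGammaLaw N) =
      ENNReal.ofReal ((N + n)! / N !) * ENNReal.ofReal ((N + n)! / N !) := by
  rw [sqrtGammaLaw, lintegral_map (by fun_prop) (by fun_prop), lintegral_prod _ (by fun_prop)]
  have h : ∀ᵐ x ∂(gammaMeasure ((N : ℝ) + 1) 1),
      ∫⁻ y, ENNReal.ofReal (√(x * y) ^ (2 * n)) ∂(gammaMeasure ((N : ℝ) + 1) 1) =
        ENNReal.ofReal (x ^ n) * ENNReal.ofReal ((N + n)! / N !) := by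
    filter_upwards [ae_pos_gammaMeasure ((N : ℝ) + 1) 1] with x hx
    rw [← lintegral_pow_gammaMeasure_succ, ← lintegral_const_mul _ (by fun_prop)]
    refine lintegral_congr_ae ?_
    filter_upwards [ae_pos_gammaMeasure ((N : ℝ) + 1) 1] with y hy
    rw [← ENNReal.ofReal_mul (by positivity), pow_mul, Real.sq_sqrt (by positivity), mul_pow]
  rw [lintegral_congr_ae h, lintegral_mul_const _ (by fun_prop), lintegral_pow_gammaMeasure_succ]

theorem lintegral_pow_cornerLaw (N n : ℕ) :
    ∫⁻ x, ENNReal.ofReal (x ^ (2 * n)) ∂(cornerLaw N) =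
      ENNReal.ofReal (N ! * (N + 2 * n)! / ((N + n)! : ℝ) ^ 2) := by
  rw [cornerLaw, lintegral_map (by fun_prop) ((measurable_entry _ _).const_sub 1).norm,
    ← integral_norm_one_sub_entry_pow, ofReal_integral_eq_lintegral_ofReal]
  · refine not_imp_comm.1 integral_undef ?_
    rw [integral_norm_one_sub_entry_pow]
    positivity
  · exact .of_forall fun x => by positivity

/-- The beta-gamma type identity behind the theorem: a gamma variable factors in law as `|1 - u|`
times an independent geometric mean of two independent copies of it. -/
theorem cornerLaw_mconv_sqrtGammaLaw (N : ℕ) :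
    cornerLaw N ∗ₘ sqrtGammaLaw N = gammaMeasure ((N : ℝ) + 1) 1 := by
  refine ext_of_even_moments ?_ ((ae_pos_gammaMeasure _ _).mono fun x hx => hx.le) (fun n => ?_)
    (s := 1 / 2) (by norm_num) (lintegral_exp_half_gammaMeasure_ne_top (by positivity))
  · have h1 : ∀ᵐ x ∂(cornerLaw N), 0 ≤ x := by
      rw [cornerLaw, ae_map_iff ((measurable_entry _ _).const_sub 1).norm.aemeasurable
        measurableSet_Ici]
      exact .of_forall fun U => norm_nonneg _
    have h2 : ∀ᵐ x ∂(sqrtGammaLaw N), 0 ≤ x := by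
      rw [sqrtGammaLaw, ae_map_iff (by fun_prop) measurableSet_Ici]
      exact .of_forall fun p => Real.sqrt_nonneg _
    rw [Measure.mconv, ae_map_iff (by fun_prop) measurableSet_Ici]
    filter_upwards [Measure.quasiMeasurePreserving_fst.ae h1,
      Measure.quasiMeasurePreserving_snd.ae h2] with p hp1 hp2
    exact mul_nonneg hp1 hp2
  · rw [Measure.lintegral_mconv (by fun_prop)]
    have h : ∀ x y : ℝ, ENNReal.ofReal ((x * y) ^ (2 * n)) =
        ENNReal.ofReal (x ^ (2 * n)) * ENNReal.ofReal (y ^ (2 * n)) := fun x y => by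
      rw [mul_pow, ENNReal.ofReal_mul ((even_two_mul n).pow_nonneg x)]
    simp_rw [h]
    simp_rw [lintegral_const_mul _
      (show Measurable fun y : ℝ => ENNReal.ofReal (y ^ (2 * n)) by fun_prop)]
    rw [lintegral_mul_const _ (by fun_prop), lintegral_pow_cornerLaw, lintegral_pow_sqrtGammaLaw,
      lintegral_pow_gammaMeasure_succ, ← ENNReal.ofReal_mul (by positivity),
      ← ENNReal.ofReal_mul (by positivity)]
    -- The identity is N! (N+2n)!/(N+n)!^2 · ((N+n)!/N!)^2 = (N+2n)!/N!.
    congr 1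
    field_simp

theorem prodLaw_gammaMeasure (N : ℕ) :
    prodLaw (fun i => gammaMeasure ((i : ℝ) + 1) 1) N =
      charNormLaw N ∗ₘ prodLaw sqrtGammaLaw N := by
  rw [charNormLaw_eq_prodLaw, ← prodLaw_mconv]
  simp_rw [cornerLaw_mconv_sqrtGammaLaw]

end CharPolyHaar

end

theorem proposition3p4 (N : ℕ) (θ : ℝ)
    {Ω : Type*} [MeasurableSpace Ω] (P : MeasureTheory.Measure Ω)
    [MeasureTheory.IsProbabilityMeasure P]
    {Ω' : Type*} [MeasurableSpace Ω'] (P' : MeasureTheory.Measure Ω')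
    [MeasureTheory.IsProbabilityMeasure P']
    -- the gamma variables of the left-hand side, on a probability space of their own
    (δ : Fin N → Ω' → ℝ)
    (hδ_law : ∀ j, ProbabilityTheory.HasLaw (δ j)
      (ProbabilityTheory.gammaMeasure ((j : ℝ) + 1) 1) P')
    (hδ_indep : ProbabilityTheory.iIndepFun δ P')
    -- the Haar unitary matrix and the gamma variables of the right-hand side, all independent
    (V : Ω → Matrix.unitaryGroup (Fin N) ℂ) (γ γ' : Fin N → Ω → ℝ)
    (hV_law : ProbabilityTheory.HasLaw V (CharPolyHaar.haarUnitary N) P)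
    (hγ_law : ∀ j, ProbabilityTheory.HasLaw (γ j)
      (ProbabilityTheory.gammaMeasure ((j : ℝ) + 1) 1) P)
    (hγ'_law : ∀ j, ProbabilityTheory.HasLaw (γ' j)
      (ProbabilityTheory.gammaMeasure ((j : ℝ) + 1) 1) P)
    (hγγ'_indep : ProbabilityTheory.iIndepFun
      (fun k : Fin N ⊕ Fin N => Sum.elim γ γ' k) P)
    (hVγγ'_indep : ProbabilityTheory.IndepFun V
      (fun ω (k : Fin N ⊕ Fin N) => Sum.elim γ γ' k ω) P) :
    ProbabilityTheory.IdentDistrib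
      (fun ω => ∏ j, δ j ω)
      (fun ω => ‖CharPolyHaar.Z (V ω) θ‖ * ∏ j, √(γ j ω * γ' j ω)) P' P := by
  open MeasureTheory ProbabilityTheory CharPolyHaar in
  have hδ := hasLaw_prod_fin (fun i => gammaMeasure ((i : ℝ) + 1) 1) N δ hδ_law hδ_indep
  have hpair := iIndepFun_prodMk_sumElim hγ_law hγ'_law hγγ'_indep
  have hsqrt_law : ∀ j : Fin N, HasLaw (fun ω => √(γ j ω * γ' j ω)) (sqrtGammaLaw j) P := fun j =>
    HasLaw.fun_comp (X := fun ω => (γ j ω, γ' j ω)) (Y := fun p : ℝ × ℝ => √(p.1 * p.2))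
      ⟨by fun_prop, rfl⟩
      ((hγγ'_indep.indepFun (i := Sum.inl j) (j := Sum.inr j) (by simp)).hasLaw_prod
        (hγ_law j) (hγ'_law j))
  have hsqrt := hasLaw_prod_fin sqrtGammaLaw N (fun j ω => √(γ j ω * γ' j ω)) hsqrt_law
    (hpair.comp (fun _ p => √(p.1 * p.2)) fun _ => by fun_prop)
  have hZ := (hasLaw_norm_Z (N := N) θ).fun_comp hV_law
  -- Both sides are measurable functions of the independent pair formed by `V` and the whole gamma
  -- family.
  have hind : IndepFun (fun ω => ‖Z (V ω) θ‖) (fun ω => ∏ j, √(γ j ω * γ' j ω)) P :=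
    hVγγ'_indep.comp (φ := fun U => ‖Z U θ‖)
      (ψ := fun x : Fin N ⊕ Fin N → ℝ => ∏ j, √(x (Sum.inl j) * x (Sum.inr j)))
      (measurable_norm_Z θ) (by fun_prop)
  have hR := hind.hasLaw_fun_mul hZ hsqrt
  exact ⟨hδ.aemeasurable, hR.aemeasurable, by
    rw [hδ.map_eq, hR.map_eq, prodLaw_gammaMeasure]⟩
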